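/- **Łoś' Theorem for AECs, part 2.** Let $K=(K,\prec)$ be an abstract elementary class in a language $L$, with Löwenheim–Skolem number $LS(K)$ (the least $\lambda\ge |L|+\aleph_0$ such that for all $M\in K$ and $A\subseteq |M|$ there is $S\prec M$ with $A\subseteq |S|$ and $\|S\|\le |A|+\lambda$), and let $\kappa$ be a measurable cardinal with $LS(K)<\kappa$. Let $U$ be a $\kappa$-complete ultrafilter on a set $I$. A *$K$-embedding* $f:M\to N$ is an embedding of $L$-structures with $f(M)\prec N$. For $M\in K$ and a set $J$, a pretype of length $J$ over $M$ is a triple $(\mathbf a,M,N)$ with $M\prec N$ and $\mathbf a=\langle a_j:j\in J\rangle$ a sequence from $N$. Write $(\mathbf a,M,N)\sim_{AT}(\mathbf b,M,N')$ if there are a model $N^*\in K$ and $K$-embeddings $f:N\to N^*$, $g:N'\to N^*$ that agree on $M$ and satisfy $f(a_j)=g(b_j)$ for all $j\in J$; let $\sim$ be the transitive closure of $\sim_{AT}$. The (Galois) type $tp(\mathbf a/M,N)$ is the $\sim$-class of $(\mathbf a,M,N)$, $S^J(M)$ is the collection of all such types, and a sequence $\mathbf a$ from $N\succ M$ realizes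 $p\in S^J(M)$ (in $N$), written $\mathbf a\vDash p$, if $tp(\mathbf a/M,N)=p$. No amalgamation property or monster model is assumed. Let $N^-\prec N\in K$, let $J$ be a set, and let $p\in S^J(N^-)$, with $\|N^-\|+|J|<\kappa$ (so $J$ is the possibly infinite length $\ell(p)$). Let $\Pi N/U$ be the ultrapower, let $h:N\to\Pi N/U$ be the canonical ultrapower embedding, sending $x$ to the class of the constant function with value $x$, and let $g$ be a function assigning to each $i\in I$ a sequence $g(i)=\langle g(i)_j : j\in J\rangle$ from $N$; write $[g]_U=\langle [\,i\mapsto g(i)_j\,]_U : j\in J\rangle$, a $J$-sequence from $\Pi N/U$. Then $h$ is a $K$-embedding (in particular $\Pi N/U\in K$), $h(N^-):=h[N^-]\prec \Pi N/U$, and $$[g]_U \text{ realizes } h(p)\in S^J(h(N^-)) \text{ in } \Pi N/U \iff \{\,i\in I : g(i)\vDash p\,\}\in U,$$ where $h(p)$ is the image of $p$ under the isomorphism $h\restriction N^-:N^-\cong h(N^-)$. -/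

import Mathlib

open FirstOrder Cardinal

universe u

/-- A class of `L`-structures (`Mem`) together with a relation between members of the class and
their substructures: `Strong S` says that the substructure `S` of `M` satisfies `S ≺ M`. -/
structure StructureClass (L : FirstOrder.Language.{u, u}) where
  Mem : ∀ (M : Type u) [L.Structure M], Prop
  Strong : ∀ {M : Type u} [L.Structure M], L.Substructure M → Prop

namespace StructureClass

variable {L : FirstOrder.Language.{u, u}} (K : StructureClass L)

/-- For substructures `S`, `T` of `M` with `S ≤ T`: the relation `S ≺ T`, where `S` is regarded
as a substructure of the structure `T`. -/
def StrongIn {M : Type u} [L.Structure M] (S T : L.Substructure M) : Prop :=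
  S ≤ T ∧ K.Strong (S.comap T.subtype.toHom)

/-- A (nonempty, well-ordered) `≺`-increasing continuous chain of members of `K`, all of them
substructures of one structure `M`. -/
structure IsContinuousChain {M : Type u} [L.Structure M] {ι : Type u} [LinearOrder ι]
    (S : ι → L.Substructure M) : Prop where
  mem : ∀ i, K.Mem (S i)
  strongIn : ∀ i j, i ≤ j → K.StrongIn (S i) (S j)
  continuous : ∀ i, Order.IsSuccLimit i → (S i : Set M) = ⋃ j : Set.Iio i, (S j : Set M)

/-- `c` witnesses the downward Löwenheim–Skolem axiom for `K`. -/
def IsLSCardinal (c : Cardinal.{u}) : Prop :=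
  L.card + ℵ₀ ≤ c ∧
    ∀ (M : Type u) [L.Structure M], K.Mem M → ∀ A : Set M,
      ∃ S : L.Substructure M, K.Strong S ∧ A ⊆ S ∧ #S ≤ #A + c

end StructureClass

/-- An abstract elementary class of `L`-structures. -/
structure AEC (L : FirstOrder.Language.{u, u}) extends StructureClass L where
  /-- `≺` is a relation between members of the class. -/
  mem_of_strong : ∀ {M : Type u} [L.Structure M] (S : L.Substructure M),
    Strong S → Mem S ∧ Mem M
  /-- `≺` is reflexive. -/
  strong_refl : ∀ (M : Type u) [L.Structure M], Mem M → Strong (⊤ : L.Substructure M)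
  /-- `≺` is transitive. -/
  strong_trans : ∀ {M : Type u} [L.Structure M] (S T : L.Substructure M),
    toStructureClass.StrongIn S T → Strong T → Strong S
  /-- Invariance under isomorphisms. -/
  mem_iso : ∀ {M N : Type u} [L.Structure M] [L.Structure N], (M ≃[L] N) → Mem M → Mem N
  strong_iso : ∀ {M N : Type u} [L.Structure M] [L.Structure N] (e : M ≃[L] N)
    (S : L.Substructure M), Strong S → Strong (S.map e.toHom)
  /-- Coherence. -/
  coherence : ∀ {M : Type u} [L.Structure M] (S T : L.Substructure M),
    Strong S → Strong T → S ≤ T → toStructureClass.StrongIn S T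
  /-- Tarski–Vaught axioms: the union of a continuous chain is in the class and is a strong
  extension of each of its members. -/
  chain_union : ∀ {M : Type u} [L.Structure M] {ι : Type u} [LinearOrder ι] [WellFoundedLT ι]
    [Nonempty ι] (S : ι → L.Substructure M), toStructureClass.IsContinuousChain S →
    (⋃ i, (S i : Set M)) = Set.univ → Mem M ∧ ∀ i, Strong (S i)
  /-- Tarski–Vaught axioms: the union of a continuous chain of strong submodels of `N` is a strong
  submodel of `N`. -/
  chain_union_strong : ∀ {N : Type u} [L.Structure N] {ι : Type u} [LinearOrder ι]
    [WellFoundedLT ι] [Nonempty ι] (S : ι → L.Substructure N),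
    toStructureClass.IsContinuousChain S → (∀ i, Strong (S i)) →
    ∀ T : L.Substructure N, (T : Set N) = ⋃ i, (S i : Set N) → Strong T
  /-- A Löwenheim–Skolem number exists. -/
  exists_ls : ∃ c : Cardinal.{u}, toStructureClass.IsLSCardinal c

namespace AEC

variable {L : FirstOrder.Language.{u, u}} (K : AEC L)

/-- The Löwenheim–Skolem number `LS(K)`: the least cardinal as in the Löwenheim–Skolem axiom. -/
noncomputable def LS : Cardinal.{u} :=
  sInf {c | K.IsLSCardinal c}

/-- `K`-embeddings: embeddings `f : M → N` with `f(M) ≺ N`. -/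
def IsEmbedding {M N : Type u} [L.Structure M] [L.Structure N] (f : M ↪[L] N) : Prop :=
  K.Strong f.toHom.range

variable {K} in
theorem isEmbedding_refl {M : Type u} [L.Structure M] (hM : K.Mem M) :
    K.IsEmbedding (FirstOrder.Language.Embedding.refl L M) := by
  have h : (FirstOrder.Language.Embedding.refl L M).toHom.range = ⊤ := by
    ext x
    simp
  unfold IsEmbedding
  rw [h]
  exact K.strong_refl M hM

variable {K} in
theorem isEmbedding_subtype {N : Type u} [L.Structure N] {S : L.Substructure N}
    (hS : K.Strong S) : K.IsEmbedding S.subtype := by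
  unfold IsEmbedding
  rw [FirstOrder.Language.Substructure.range_subtype]
  exact hS

variable {K} in
theorem isEmbedding_comp_equiv {M M' N : Type u} [L.Structure M] [L.Structure M'] [L.Structure N]
    {f : M ↪[L] N} (hf : K.IsEmbedding f) (e : M' ≃[L] M) :
    K.IsEmbedding (f.comp e.toEmbedding) := by
  have h : (f.comp e.toEmbedding).toHom.range = f.toHom.range := by
    ext x
    constructor
    · rintro ⟨y, rfl⟩
      exact ⟨e y, rfl⟩
    · rintro ⟨y, rfl⟩
      exact ⟨e.symm y, by simp⟩
  unfold IsEmbedding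
  rw [h]
  exact hf

/-- Pretypes of length `J` over `M`: triples `(⟨a_j : j ∈ J⟩, M, N)` with `M ≺ N` and all `a_j` in
`N`. The inclusion of `M` in `N` is recorded as a `K`-embedding. -/
structure Pretype (J M : Type u) [L.Structure M] where
  N : Type u
  [str : L.Structure N]
  incl : M ↪[L] N
  isEmbedding : K.IsEmbedding incl
  a : J → N

attribute [instance] Pretype.str

variable {K}

/-- Atomic equivalence: the two ambient models can be amalgamated over `M` so that the
two sequences are identified. -/
def Pretype.AtomicEquiv {J M : Type u} [L.Structure M] (p q : K.Pretype J M) : Prop :=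
  ∃ (N' : Type u) (_ : L.Structure N') (f : p.N ↪[L] N') (g : q.N ↪[L] N'),
    K.IsEmbedding f ∧ K.IsEmbedding g ∧
    (∀ j, f (p.a j) = g (q.a j)) ∧ ∀ m, f (p.incl m) = g (q.incl m)

theorem Pretype.AtomicEquiv.refl {J M : Type u} [L.Structure M] (p : K.Pretype J M) :
    p.AtomicEquiv p :=
  ⟨p.N, p.str, FirstOrder.Language.Embedding.refl L p.N, FirstOrder.Language.Embedding.refl L p.N,
    isEmbedding_refl (K.mem_of_strong _ p.isEmbedding).2,
    isEmbedding_refl (K.mem_of_strong _ p.isEmbedding).2, fun _ => rfl, fun _ => rfl⟩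

theorem Pretype.AtomicEquiv.symm {J M : Type u} [L.Structure M] {p q : K.Pretype J M}
    (h : p.AtomicEquiv q) : q.AtomicEquiv p := by
  obtain ⟨N', s, f, g, hf, hg, h1, h2⟩ := h
  exact ⟨N', s, g, f, hg, hf, fun j => (h1 j).symm, fun m => (h2 m).symm⟩

variable (K)

/-- The equivalence of pretypes: the transitive closure of atomic equivalence. -/
def pretypeSetoid (J M : Type u) [L.Structure M] : Setoid (K.Pretype J M) where
  r := Relation.TransGen Pretype.AtomicEquiv
  iseqv :=
    { refl := fun p => .single (.refl p)
      symm := fun {_ _} h => by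
        induction h with
        | single h => exact .single h.symm
        | tail _ h ih => exact .trans (.single h.symm) ih
      trans := fun h h' => h.trans h' }

/-- `S^J(M)`: the set of Galois types of length `J` over `M`. -/
def GaloisType (J M : Type u) [L.Structure M] : Type (u + 1) :=
  Quotient (K.pretypeSetoid J M)

variable {K}

/-- `tp(a/S, N)` for a strong submodel `S ≺ N` and a `J`-sequence `a` from `N`. -/
def tp {N : Type u} [L.Structure N] {S : L.Substructure N} (hS : K.Strong S) {J : Type u}
    (a : J → N) : K.GaloisType J S :=
  Quotient.mk (K.pretypeSetoid J S) ⟨N, S.subtype, isEmbedding_subtype hS, a⟩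

/-- The `J`-sequence `a` from `N` realizes the type `p ∈ S^J(S)`, where `S ≺ N`. -/
def Realizes {N : Type u} [L.Structure N] {S : L.Substructure N} (hS : K.Strong S) {J : Type u}
    (a : J → N) (p : K.GaloisType J S) : Prop :=
  tp hS a = p

/-- The image of a pretype under an isomorphism `e : M ≃ M'` of its domain. -/
def Pretype.map {J M M' : Type u} [L.Structure M] [L.Structure M'] (e : M ≃[L] M')
    (p : K.Pretype J M) : K.Pretype J M' where
  N := p.N
  incl := p.incl.comp e.symm.toEmbedding
  isEmbedding := isEmbedding_comp_equiv p.isEmbedding e.symm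
  a := p.a

/-- The image `e(p) ∈ S^J(M')` of a type `p ∈ S^J(M)` under an isomorphism `e : M ≃ M'`. -/
def GaloisType.map {J M M' : Type u} [L.Structure M] [L.Structure M'] (e : M ≃[L] M') :
    K.GaloisType J M → K.GaloisType J M' :=
  Quotient.map' (s₁ := K.pretypeSetoid J M) (s₂ := K.pretypeSetoid J M') (Pretype.map e)
    (fun p q h => by
      have h' : Relation.TransGen Pretype.AtomicEquiv p q := h
      refine Relation.TransGen.lift (r := Pretype.AtomicEquiv) (p := Pretype.AtomicEquiv)
        (Pretype.map e) ?_ _ _ h'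
      rintro a b ⟨N', s, f, g, hf, hg, h1, h2⟩
      exact ⟨N', s, f, g, hf, hg, h1, fun m => h2 (e.symm m)⟩)

end AEC

/-- The ultrapower `ΠN/U`. -/
abbrev Ultrapower {I : Type u} (U : Ultrafilter I) (N : Type u) : Type u :=
  (U : Filter I).Product fun _ => N

/-- The class `[g]_U` of a function `g : I → N`. -/
def ultraClass {I : Type u} (U : Ultrafilter I) {N : Type u} (g : I → N) : Ultrapower U N :=
  Quotient.mk ((U : Filter I).productSetoid fun _ => N) g

/-- The canonical ultrapower embedding `N → ΠN/U`, sending `x` to the class of the constant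
function with value `x`. -/
def ultrapowerEmbedding {L : FirstOrder.Language.{u, u}} {I : Type u} (U : Ultrafilter I)
    (N : Type u) [L.Structure N] : N ↪[L] Ultrapower U N where
  toFun x := ultraClass U fun _ => x
  inj' x y h := by
    have h' : ∀ᶠ _ in (U : Filter I), x = y :=
      Quotient.exact (s := (U : Filter I).productSetoid fun _ => N) h
    exact h'.exists.elim fun _ h => h
  map_fun' {n} f x :=
    (FirstOrder.Language.Ultraproduct.funMap_cast (u := U) f fun i _ => x i).symm
  map_rel' {n} r x := by
    refine (FirstOrder.Language.relMap_quotient_mk'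
      (s := (U : Filter I).productSetoid fun _ => N) (ps :=
        FirstOrder.Language.Ultraproduct.setoidPrestructure (fun _ => N) U) r
        (fun i _ => x i)).trans ?_
    exact Filter.eventually_const

/-- `κ` is measurable: uncountable and carrying a `κ`-complete nonprincipal ultrafilter. -/
def IsMeasurableCardinal (κ : Cardinal.{u}) : Prop :=
  ℵ₀ < κ ∧ ∃ D : Ultrafilter κ.out,
    CardinalInterFilter (D : Filter κ.out) κ ∧ ∀ x : κ.out, {x} ∉ D

/-! The argument passes through a Skolemization of `N`, in the spirit of Shelah's presentation
theorem. The model `N` is expanded to a language `L'` with at most `LS(K) < κ` symbols in which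
every `L'`-substructure has an `L`-reduct strong in `N` (`exists_isSkolemized`).

Since `U` is `κ`-complete, an `L'`-substructure `T` of the ultrapower of size `< κ` embeds into `N`
through coordinate `i` of chosen representatives, for almost all `i`
(`eventually_exists_embedding`): fewer than `κ` atomic conditions have to hold at once. Every such
image is strong in `N`, so by coherence small `L'`-substructures of the ultrapower are strong in one
another. The chain axioms lift this to all `L'`-substructures (`strongIn_of_finitary`), so the
ultrapower is Skolemized too. In particular it is in `K`, and the range of `h`, being an
`L'`-substructure, is strong in it.

For types, let `T` be the `L'`-closure of `h(N₀)` together with `[g]_U`. It is small and strong in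
the ultrapower, and for almost all `i` it maps into `N` by a `K`-embedding that sends `h(x)` to `x`
and `[g]_U` to `g(i)`. Hence `[g]_U`, with `N₀` embedded through `h`, has the same type over `N₀` as
`g(i)` for almost all `i` (`IsSkolemized.eventually_tp_eq`). No amalgamation is needed because `T`
maps directly into both models. -/

namespace AEC

open FirstOrder.Language

variable {L : FirstOrder.Language.{u, u}} {K : AEC L}

/-! ### Calculus of `K`-embeddings and of the relation `StrongIn`. -/

theorem IsEmbedding.mem_left {M N : Type u} [L.Structure M] [L.Structure N] {f : M ↪[L] N}
    (hf : K.IsEmbedding f) : K.Mem M :=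
  K.mem_iso f.equivRange.symm (K.mem_of_strong _ hf).1

theorem IsEmbedding.mem_right {M N : Type u} [L.Structure M] [L.Structure N] {f : M ↪[L] N}
    (hf : K.IsEmbedding f) : K.Mem N :=
  (K.mem_of_strong _ hf).2

theorem isEmbedding_equiv_comp {M N N' : Type u} [L.Structure M] [L.Structure N]
    [L.Structure N'] {f : M ↪[L] N} (hf : K.IsEmbedding f) (e : N ≃[L] N') :
    K.IsEmbedding (e.toEmbedding.comp f) := by
  have h : (e.toEmbedding.comp f).toHom.range = f.toHom.range.map e.toHom := by
    ext x
    simp only [Hom.mem_range, Substructure.mem_map, exists_exists_eq_and]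
    rfl
  unfold IsEmbedding
  rw [h]
  exact K.strong_iso e _ hf

/-- Converts relative strength into a statement about maps, so that it can be composed, cancelled
and transported along isomorphisms. -/
theorem strongIn_iff_isEmbedding_inclusion {M : Type u} [L.Structure M] {S T : L.Substructure M}
    (h : S ≤ T) : K.StrongIn S T ↔ K.IsEmbedding (Substructure.inclusion h) := by
  have h' : (Substructure.inclusion h).toHom.range = S.comap T.subtype.toHom := by
    ext x
    constructor
    · rintro ⟨y, rfl⟩
      exact y.2
    · intro hx
      exact ⟨⟨x.1, hx⟩, rfl⟩
  unfold IsEmbedding StructureClass.StrongIn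
  rw [h']
  exact and_iff_right h

theorem strongIn_top_iff {M : Type u} [L.Structure M] {S : L.Substructure M} :
    K.StrongIn S ⊤ ↔ K.Strong S := by
  rw [strongIn_iff_isEmbedding_inclusion le_top]
  have h : S.subtype = (Substructure.topEquiv (L := L) (M := M)).toEmbedding.comp
      (Substructure.inclusion (le_top : S ≤ ⊤)) := by
    ext x
    rfl
  have h' : Substructure.inclusion (le_top : S ≤ ⊤) =
      (Substructure.topEquiv (L := L) (M := M)).symm.toEmbedding.comp S.subtype := by
    ext x
    rfl
  constructor
  · intro hS
    have := isEmbedding_equiv_comp hS (Substructure.topEquiv (L := L) (M := M))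
    rw [← h] at this
    unfold IsEmbedding at this
    rwa [Substructure.range_subtype] at this
  · intro hS
    rw [h']
    exact isEmbedding_equiv_comp (isEmbedding_subtype hS) _

theorem IsEmbedding.comp {M N P : Type u} [L.Structure M] [L.Structure N] [L.Structure P]
    {g : N ↪[L] P} {f : M ↪[L] N} (hg : K.IsEmbedding g) (hf : K.IsEmbedding f) :
    K.IsEmbedding (g.comp f) := by
  refine K.strong_trans _ g.toHom.range ?_ hg
  have hle : (g.comp f).toHom.range ≤ g.toHom.range := by
    rintro _ ⟨y, rfl⟩
    exact ⟨f y, rfl⟩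
  rw [strongIn_iff_isEmbedding_inclusion hle]
  have : Substructure.inclusion hle =
      (g.equivRange.toEmbedding.comp f).comp (g.comp f).equivRange.symm.toEmbedding := by
    ext x
    obtain ⟨y, rfl⟩ := (g.comp f).equivRange.surjective x
    change g (f y) = g (f ((g.comp f).equivRange.symm ((g.comp f).equivRange y)))
    rw [FirstOrder.Language.Equiv.symm_apply_apply]
  rw [this]
  exact isEmbedding_comp_equiv (isEmbedding_equiv_comp hf _) _

/-- This is the coherence axiom in the language of embeddings. -/
theorem IsEmbedding.of_comp {M N P : Type u} [L.Structure M] [L.Structure N] [L.Structure P]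
    {g : N ↪[L] P} {f : M ↪[L] N} (hg : K.IsEmbedding g) (hgf : K.IsEmbedding (g.comp f)) :
    K.IsEmbedding f := by
  have hle : (g.comp f).toHom.range ≤ g.toHom.range := by
    rintro _ ⟨y, rfl⟩
    exact ⟨f y, rfl⟩
  have h := K.coherence _ _ hgf hg hle
  rw [strongIn_iff_isEmbedding_inclusion hle] at h
  have : f = (g.equivRange.symm.toEmbedding.comp (Substructure.inclusion hle)).comp
      (g.comp f).equivRange.toEmbedding := by
    ext x
    apply g.equivRange.injective
    change g.equivRange (f x) =
      g.equivRange (g.equivRange.symm (Substructure.inclusion hle ((g.comp f).equivRange x)))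
    rw [FirstOrder.Language.Equiv.apply_symm_apply]
    rfl
  rw [this]
  exact isEmbedding_comp_equiv (isEmbedding_equiv_comp h _) _

theorem strongIn_trans {M : Type u} [L.Structure M] {S T V : L.Substructure M}
    (h : K.StrongIn S T) (h' : K.StrongIn T V) : K.StrongIn S V := by
  have hST := h.1
  have hTV := h'.1
  rw [strongIn_iff_isEmbedding_inclusion hST] at h
  rw [strongIn_iff_isEmbedding_inclusion hTV] at h'
  rw [strongIn_iff_isEmbedding_inclusion (hST.trans hTV)]
  exact h'.comp h

theorem mem_of_strongIn {M : Type u} [L.Structure M] {S T : L.Substructure M}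
    (h : K.StrongIn S T) : K.Mem S ∧ K.Mem T := by
  have hST := h.1
  rw [strongIn_iff_isEmbedding_inclusion hST] at h
  exact ⟨h.mem_left, h.mem_right⟩

end AEC

/-- For `S ≤ V`, the substructure of `V` with the same elements as `S` is isomorphic to `S`. -/
def FirstOrder.Language.Substructure.comapSubtypeEquiv {L : FirstOrder.Language.{u, u}}
    {M : Type u} [L.Structure M] {S V : L.Substructure M} (h : S ≤ V) :
    S.comap V.subtype.toHom ≃[L] S where
  toFun x := ⟨x.1.1, x.2⟩
  invFun x := ⟨⟨x.1, h x.2⟩, x.2⟩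
  left_inv _ := rfl
  right_inv _ := rfl
  map_fun' _ _ := rfl
  map_rel' _ _ := Iff.rfl

/-! ### Unions of chains and of finitary families. -/

namespace AEC

open FirstOrder.Language

variable {L : FirstOrder.Language.{u, u}} {K : AEC L}

theorem strongIn_comap_subtype {M : Type u} [L.Structure M] {S T V : L.Substructure M}
    (hTV : T ≤ V) (h : K.StrongIn S T) :
    K.StrongIn (S.comap V.subtype.toHom) (T.comap V.subtype.toHom) := by
  have hST := h.1
  have hle : S.comap V.subtype.toHom ≤ T.comap V.subtype.toHom := fun x hx => hST hx
  rw [strongIn_iff_isEmbedding_inclusion hST] at h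
  rw [strongIn_iff_isEmbedding_inclusion hle]
  exact isEmbedding_equiv_comp
    (isEmbedding_comp_equiv h (Substructure.comapSubtypeEquiv (hST.trans hTV)))
    (Substructure.comapSubtypeEquiv hTV).symm

theorem isContinuousChain_comap_subtype {M : Type u} [L.Structure M] {ι : Type u}
    [LinearOrder ι] {S : ι → L.Substructure M} (hS : K.IsContinuousChain S)
    {V : L.Substructure M} (hV : ∀ i, S i ≤ V) :
    K.IsContinuousChain fun i => (S i).comap V.subtype.toHom where
  mem i := K.mem_iso (Substructure.comapSubtypeEquiv (hV i)).symm (hS.mem i)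
  strongIn i j hij := strongIn_comap_subtype (hV j) (hS.strongIn i j hij)
  continuous i hi := by
    ext x
    have := congrArg (fun A : Set M => x.1 ∈ A) (hS.continuous i hi)
    simpa using this

/-- The axiom `chain_union` requires the chain to exhaust its ambient structure, so the chain is
first pulled back to `V`. -/
theorem strongIn_of_chain {M : Type u} [L.Structure M] {ι : Type u} [LinearOrder ι]
    [WellFoundedLT ι] [Nonempty ι] {S : ι → L.Substructure M} (hS : K.IsContinuousChain S)
    {V : L.Substructure M} (hV : (V : Set M) = ⋃ i, (S i : Set M)) (i : ι) :
    K.StrongIn (S i) V := by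
  have hle : ∀ i, S i ≤ V := fun i x hx => by
    have : x ∈ (V : Set M) := hV ▸ Set.mem_iUnion_of_mem i hx
    exact this
  refine ⟨hle i, (K.chain_union _ (isContinuousChain_comap_subtype hS hle) ?_).2 i⟩
  ext x
  have hx : x.1 ∈ (V : Set M) := x.2
  rw [hV] at hx
  simpa using hx

theorem strongIn_of_chain_of_strongIn {M : Type u} [L.Structure M] {ι : Type u} [LinearOrder ι]
    [WellFoundedLT ι] [Nonempty ι] {S : ι → L.Substructure M} (hS : K.IsContinuousChain S)
    {V : L.Substructure M} (hV : ∀ i, K.StrongIn (S i) V) {T : L.Substructure M}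
    (hT : (T : Set M) = ⋃ i, (S i : Set M)) : K.StrongIn T V := by
  have hTV : T ≤ V := fun x hx => by
    have hx : x ∈ (T : Set M) := hx
    rw [hT] at hx
    obtain ⟨i, hi⟩ := Set.mem_iUnion.1 hx
    exact (hV i).1 hi
  refine ⟨hTV, K.chain_union_strong _ (isContinuousChain_comap_subtype hS fun i => (hV i).1)
    (fun i => (hV i).2) _ ?_⟩
  ext x
  have := congrArg (fun A : Set M => x.1 ∈ A) hT
  simpa using this

/-- A monotone finitary family of substructures, indexed by the subsets of a set, is
`≺`-increasing as soon as its restriction to finite sets is. -/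
theorem strongIn_of_finitary {M X : Type u} [L.Structure M] {C : Set X → L.Substructure M}
    (hmono : Monotone C)
    (hfin : ∀ A, ∀ x ∈ C A, ∃ B : Set X, B.Finite ∧ B ⊆ A ∧ x ∈ C B)
    (hstrong : ∀ A B : Set X, B.Finite → A ⊆ B → K.StrongIn (C A) (C B))
    (A B : Set X) (hAB : A ⊆ B) : K.StrongIn (C A) (C B) := by
  induction hc : #B using WellFoundedLT.induction generalizing A B with
  | ind c ih =>
    subst hc
    by_cases hB : B.Finite
    · exact hstrong A B hB hAB
    have hB' : ℵ₀ ≤ #B := by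
      have : Infinite B := Set.infinite_coe_iff.2 hB
      exact Cardinal.aleph0_le_mk B
    -- Enumerating `B` along its initial ordinal makes every proper initial segment smaller than
    -- `B`, so the induction hypothesis applies to it.
    let ι := (#B).ord.ToType
    have hne : Nonempty ι := by
      rw [← Cardinal.mk_ne_zero_iff, Cardinal.mk_ord_toType]
      exact (Cardinal.aleph0_pos.trans_le hB').ne'
    have : NoMaxOrder ι := Cardinal.noMaxOrder hB'
    obtain ⟨e⟩ : Nonempty (ι ≃ B) := Cardinal.eq.1 (Cardinal.mk_ord_toType _)
    -- Strict initial segments give continuity at limits; they still exhaust `B` because `ι` has no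
    -- maximum.
    let D : ι → Set X := fun i => (fun j => (e j : X)) '' Set.Iio i
    have hDB : ∀ i, D i ⊆ B := by
      rintro i _ ⟨j, -, rfl⟩
      exact (e j).2
    have hDmono : Monotone D := fun i j hij => Set.image_mono (Set.Iio_subset_Iio hij)
    have hDcard : ∀ i, #(D i) < #B := fun i =>
      Cardinal.mk_image_le.trans_lt 
        ((Cardinal.mk_Iio_lt i (by rw [Cardinal.mk_ord_toType, Ordinal.type_toType])).trans_eq
          (Cardinal.mk_ord_toType _))
    have hmemD : ∀ x (hx : x ∈ B) i, x ∈ D i ↔ e.symm ⟨x, hx⟩ < i := by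
      intro x hx i
      constructor
      · rintro ⟨j, hj, rfl⟩
        simpa using hj
      · intro h
        exact ⟨_, h, by simp⟩
    have hunion : ∀ F : Set X, F.Finite → F ⊆ B → ∃ i, F ⊆ D i := by
      intro F hF hFB
      have := hF.to_subtype
      obtain ⟨i, hi⟩ := Finite.exists_le fun x : F => e.symm ⟨x, hFB x.2⟩
      obtain ⟨k, hk⟩ := exists_gt i
      exact ⟨k, fun x hx => (hmemD x (hFB hx) k).2 ((hi ⟨x, hx⟩).trans_lt hk)⟩
    have hlim : ∀ i : ι, Order.IsSuccLimit i → ∀ F : Set X, F.Finite → F ⊆ D i →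
        ∃ j < i, F ⊆ D j := by
      intro i hi F hF hFD
      have hFB := hFD.trans (hDB i)
      have := hF.to_subtype
      rcases F.eq_empty_or_nonempty with rfl | hFne
      · obtain ⟨j, hj⟩ := not_isMin_iff.1 hi.1
        exact ⟨j, hj, Set.empty_subset _⟩
      have := hFne.to_subtype
      obtain ⟨x, hx⟩ := Finite.exists_max fun x : F => e.symm ⟨x, hFB x.2⟩
      have hxi := (hmemD x (hFB x.2) i).1 (hFD x.2)
      obtain ⟨k, hk, hki⟩ := hi.lt_iff_exists_lt.1 hxi
      exact ⟨k, hk, fun y hy => (hmemD y (hFB hy) k).2 ((hx ⟨y, hy⟩).trans_lt hki)⟩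
    have hcont : ∀ A : Set X, ∀ i : ι, Order.IsSuccLimit i →
        (C (A ∩ D i) : Set M) = ⋃ j : Set.Iio i, (C (A ∩ D j) : Set M) := by
      intro A i hi
      apply Set.Subset.antisymm
      · intro x hx
        obtain ⟨F, hF, hFA, hxF⟩ := hfin _ x hx
        obtain ⟨j, hj, hFj⟩ := hlim i hi F hF (hFA.trans Set.inter_subset_right)
        exact Set.mem_iUnion.2 ⟨⟨j, hj⟩,
          hmono (Set.subset_inter (hFA.trans Set.inter_subset_left) hFj) hxF⟩
      · refine Set.iUnion_subset fun j => ?_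
        exact hmono (Set.inter_subset_inter_right A (hDmono (le_of_lt j.2)))
    have hall : ∀ A ⊆ B, (C A : Set M) = ⋃ i, (C (A ∩ D i) : Set M) := by
      intro A hAB
      apply Set.Subset.antisymm
      · intro x hx
        obtain ⟨F, hF, hFA, hxF⟩ := hfin _ x hx
        obtain ⟨j, hFj⟩ := hunion F hF (hFA.trans hAB)
        exact Set.mem_iUnion.2 ⟨j, hmono (Set.subset_inter hFA hFj) hxF⟩
      · exact Set.iUnion_subset fun j => hmono Set.inter_subset_left
    -- `A` itself may be as large as `B`, so it is cut down by the segments `D i` as well.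
    have hchain : ∀ A ⊆ B, K.IsContinuousChain fun i => C (A ∩ D i) := by
      intro A hAB
      have hs : ∀ i j, i ≤ j → K.StrongIn (C (A ∩ D i)) (C (A ∩ D j)) := fun i j hij =>
        ih _ ((Cardinal.mk_le_mk_of_subset Set.inter_subset_right).trans_lt (hDcard j)) _ _
          (Set.inter_subset_inter_right A (hDmono hij)) rfl
      exact ⟨fun i => (mem_of_strongIn (hs i i le_rfl)).1, hs, hcont A⟩
    -- `C A` is the union of the chain `C (A ∩ D i)`, and `C (A ∩ D i) ≺ C (B ∩ D i) ≺ C B` by the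
    -- induction hypothesis and the chain axiom for `B`.
    refine strongIn_of_chain_of_strongIn (hchain A hAB) (fun i => ?_) (hall A hAB)
    have h1 : K.StrongIn (C (B ∩ D i)) (C B) :=
      strongIn_of_chain (hchain B subset_rfl) (hall B subset_rfl) i
    refine strongIn_trans (ih _ ?_ _ _ (Set.inter_subset_inter_left _ hAB) rfl) h1
    exact (Cardinal.mk_le_mk_of_subset Set.inter_subset_right).trans_lt (hDcard i)

end AEC

/-! ### Skolemization of a model in a language of size at most `LS(K)`. -/

/-- The language with a `Λ`-indexed family of function symbols in each arity. -/
def skolemLanguage (Λ : Type u) : FirstOrder.Language.{u, u} :=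
  ⟨fun _ => Λ, fun _ => PEmpty⟩

theorem card_skolemLanguage_le {Λ : Type u} {c : Cardinal.{u}} (hΛ : #Λ ≤ c) (hc : ℵ₀ ≤ c) :
    (skolemLanguage Λ).card ≤ c := by
  have h2 : #(Σ n, (skolemLanguage Λ).Relations n) = 0 :=
    Cardinal.mk_eq_zero_iff.2 ⟨fun x => PEmpty.elim x.2⟩
  have h1 : #(Σ n, (skolemLanguage Λ).Functions n) ≤ c := by
    have : #(Σ n, (skolemLanguage Λ).Functions n) = #(ULift.{u} ℕ × Λ) :=
      Cardinal.mk_congr ⟨fun x => (⟨x.1⟩, x.2), fun x => ⟨x.1.down, x.2⟩, fun _ => rfl, fun _ => rfl⟩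
    rw [this, Cardinal.mk_prod, Cardinal.lift_id, Cardinal.lift_id]
    exact Cardinal.mul_le_of_le hc (by simpa using hc) hΛ
  change #((Σ n, (skolemLanguage Λ).Functions n) ⊕ (Σ n, (skolemLanguage Λ).Relations n)) ≤ c
  rw [Cardinal.mk_sum, h2]
  simpa using h1

namespace AEC

open FirstOrder.Language

variable {L : FirstOrder.Language.{u, u}} {K : AEC L}

/-- `N` is Skolemized by its expansion to a structure in a larger language if every substructure
of the expansion is strong in `N`. -/
def IsSkolemized (K : AEC L) {L' : FirstOrder.Language.{u, u}} (φ : L →ᴸ L') (N : Type u)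
    [L.Structure N] [L'.Structure N] [φ.IsExpansionOn N] : Prop :=
  ∀ T : L'.Substructure N, K.Strong (φ.substructureReduct T)

theorem isLSCardinal_LS (K : AEC L) : K.IsLSCardinal K.LS :=
  csInf_mem (s := {c | K.IsLSCardinal c}) K.exists_ls

theorem card_le_LS (K : AEC L) : L.card ≤ K.LS :=
  le_self_add.trans (isLSCardinal_LS K).1

theorem aleph0_le_LS (K : AEC L) : ℵ₀ ≤ K.LS :=
  le_add_self.trans (isLSCardinal_LS K).1

/-- Every model is the union of a directed system of small strong submodels indexed by its finite
subsets. -/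
theorem exists_strong_system {N : Type u} [L.Structure N] (hN : K.Mem N) (x₀ : N) :
    ∃ S : Finset N → L.Substructure N, Monotone S ∧
      ∀ A, K.Strong (S A) ∧ ↑A ⊆ (S A : Set N) ∧ x₀ ∈ S A ∧ #(S A) ≤ K.LS := by
  choose G hG using (isLSCardinal_LS K).2 N hN
  -- The hull of `A` is made to contain the hulls of its finitely many proper subsets, which forces
  -- monotonicity. The point `x₀` keeps every hull nonempty, so that it can be enumerated.
  let S : Finset N → L.Substructure N := (wellFounded_lt (α := Finset N)).fix fun A ih =>
    G (insert x₀ ((A : Set N) ∪ ⋃ B : Set.Iio A, (ih B.1 B.2 : Set N)))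
  have hS : ∀ A, S A = G (insert x₀ ((A : Set N) ∪ ⋃ B : Set.Iio A, (S B.1 : Set N))) := fun A =>
    WellFounded.fix_eq _ _ A
  have hsub : ∀ A : Finset N, insert x₀ ((A : Set N) ∪ ⋃ B : Set.Iio A, (S B.1 : Set N)) ⊆ (S A : Set N) := fun A => by
    conv_rhs => rw [hS A]
    exact (hG _).2.1
  have hc := aleph0_le_LS K
  refine ⟨S, fun B A hBA => ?_, fun A => ⟨?_, ?_, ?_, ?_⟩⟩
  · rcases hBA.eq_or_lt with rfl | h
    · exact le_rfl
    · intro x hx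
      refine hsub A (Or.inr (Or.inr ?_))
      exact Set.mem_iUnion.2 ⟨(⟨B, h⟩ : Set.Iio A), hx⟩
  · rw [hS]
    exact (hG _).1
  · exact fun x hx => hsub A (Or.inr (Or.inl hx))
  · exact hsub A (Or.inl rfl)
  · induction A using WellFoundedLT.induction with
    | ind A ih =>
      rw [hS]
      refine (hG _).2.2.trans (Cardinal.add_le_of_le hc ?_ le_rfl)
      refine Cardinal.mk_insert_le.trans (Cardinal.add_le_of_le hc ?_ ?_)
      · refine (Cardinal.mk_union_le _ _).trans (Cardinal.add_le_of_le hc ?_ ?_)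
        · exact (Cardinal.lt_aleph0_of_finite _).le.trans hc
        · classical
          have : Finite (Set.Iio A) := Set.finite_Iio A
          refine Cardinal.mk_iUnion_le_sum_mk.trans
            ((Cardinal.sum_le_sum (fun B : Set.Iio A => #(S B.1)) (fun _ => K.LS) fun B => ih B.1 B.2).trans ?_)
          rw [Cardinal.sum_const']
          exact Cardinal.mul_le_of_le hc ((Cardinal.lt_aleph0_of_finite _).le.trans hc) le_rfl
      · exact Cardinal.one_le_aleph0.trans hc

/-- Every model has an expansion to a language of size at most `LS(K)` which Skolemizes it. -/
theorem exists_isSkolemized {N : Type u} [L.Structure N] (hN : K.Mem N) :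
    ∃ (L' : FirstOrder.Language.{u, u}) (φ : L →ᴸ L') (_ : L'.Structure N)
      (_ : φ.IsExpansionOn N), L'.card ≤ K.LS ∧ K.IsSkolemized φ N := by
  -- The Skolem language has constants, which an empty model cannot interpret; there `L` itself
  -- works.
  rcases isEmpty_or_nonempty N with hN' | ⟨⟨x₀⟩⟩
  · refine ⟨L, LHom.id L, inferInstance, inferInstance, card_le_LS K, fun T => ?_⟩
    have : (LHom.id L).substructureReduct T = ⊤ := by
      ext x
      exact hN'.elim x
    rw [this]
    exact K.strong_refl N hN
  obtain ⟨S, hS, hS'⟩ := exists_strong_system hN x₀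
  have hsurj : ∀ A, ∃ f : K.LS.out → N, Set.range f = S A := by
    intro A
    have hle : #(S A) ≤ #K.LS.out := by
      rw [Cardinal.mk_out]
      exact (hS' A).2.2.2
    obtain ⟨f⟩ := hle
    have : Nonempty (S A) := ⟨⟨x₀, (hS' A).2.2.1⟩⟩
    refine ⟨fun l => (Function.invFun f l : S A), ?_⟩
    have := (Function.invFun_surjective f.injective).range_comp (Subtype.val : S A → N)
    exact this.trans Subtype.range_coe
  choose enum henum using hsurj
  classical
  -- The symbol `l` applied to a tuple returns the `l`-th element of the hull of its set of entries.
  -- A set closed under these functions contains the hull of each of its finite subsets.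
  let s : (skolemLanguage.{u} K.LS.out).Structure N :=
    { funMap := fun {n} l v => enum (Finset.univ.image v) l
      RelMap := fun {n} r _ => PEmpty.elim r }
  refine ⟨L.sum (skolemLanguage K.LS.out), LHom.sumInl, inferInstance, inferInstance, ?_, ?_⟩
  · rw [FirstOrder.Language.card_sum, Cardinal.lift_id, Cardinal.lift_id]
    exact Cardinal.add_le_of_le (aleph0_le_LS K) (card_le_LS K)
      (card_skolemLanguage_le (Cardinal.mk_out _).le (aleph0_le_LS K))
  intro T
  -- `C` extends the system of hulls from finite sets to all sets. It takes the value `T` at `T` and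
  -- `N` at `Set.univ`, so `strongIn_of_finitary` gives `T ≺ N`.
  let C : Set N → L.Substructure N := fun A => ⨆ B : {B : Finset N // (B : Set N) ⊆ A}, S B
  have hC : ∀ A x, x ∈ C A ↔ ∃ B : Finset N, (B : Set N) ⊆ A ∧ x ∈ S B := by
    intro A x
    have : Nonempty {B : Finset N // (B : Set N) ⊆ A} := ⟨⟨∅, by simp⟩⟩
    rw [Substructure.mem_iSup_of_directed]
    · simp
    · intro B B'
      refine ⟨⟨B.1 ∪ B'.1, ?_⟩, hS Finset.subset_union_left, hS Finset.subset_union_right⟩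
      rw [Finset.coe_union]
      exact Set.union_subset B.2 B'.2
  have hCfin : ∀ A : Finset N, C A = S A := by
    intro A
    ext x
    rw [hC]
    constructor
    · rintro ⟨B, hBA, hx⟩
      exact hS (Finset.coe_subset.1 hBA) hx
    · exact fun hx => ⟨A, subset_rfl, hx⟩
  have hCmono : Monotone C := by
    intro A B hAB x hx
    rw [hC] at hx ⊢
    obtain ⟨F, hF, hx⟩ := hx
    exact ⟨F, hF.trans hAB, hx⟩
  have hstrong := strongIn_of_finitary (K := K) hCmono ?_ ?_ T Set.univ (Set.subset_univ _)
  · have htop : C Set.univ = ⊤ := by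
      ext x
      simp only [Substructure.mem_top, iff_true]
      exact (hC _ _).2 ⟨{x}, Set.subset_univ _, (hS' {x}).2.1 (by simp)⟩
    have hCT : C T = LHom.sumInl.substructureReduct T := by
      ext x
      rw [hC, LHom.mem_substructureReduct]
      constructor
      · rintro ⟨B, hBT, hx⟩
        rw [← SetLike.mem_coe, ← henum] at hx
        obtain ⟨l, rfl⟩ := hx
        -- `B` is written as the set of entries of a tuple of length `B.card`, which picks the
        -- arity; the empty set corresponds to the constants.
        have hB : B = Finset.univ.image fun k => (B.equivFin.symm k : N) := by
          ext y
          simp only [Finset.mem_image, Finset.mem_univ, true_and]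
          constructor
          · exact fun hy => ⟨B.equivFin ⟨y, hy⟩, by simp⟩
          · rintro ⟨k, rfl⟩
            exact (B.equivFin.symm k).2
        rw [hB]
        exact T.fun_mem (n := B.card) (Sum.inr l) (fun k => (B.equivFin.symm k : N))
          fun k => hBT (B.equivFin.symm k).2
      · intro hx
        exact ⟨{x}, by simpa using hx, (hS' {x}).2.1 (by simp)⟩
    rw [htop, strongIn_top_iff, hCT] at hstrong
    exact hstrong
  · intro A x hx
    obtain ⟨B, hBA, hx⟩ := (hC A x).1 hx
    exact ⟨B, B.finite_toSet, hBA, by rwa [hCfin]⟩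
  · intro A B hB hAB
    have hle := hCmono hAB
    lift B to Finset N using hB
    lift A to Finset N using B.finite_toSet.subset hAB
    rw [hCfin, hCfin] at hle ⊢
    exact K.coherence _ _ (hS' A).1 (hS' B).1 hle

end AEC

/-! ### Ultrapowers and their small substructures. -/

section Ultrapower

open FirstOrder.Language

variable {L L' : FirstOrder.Language.{u, u}} {I : Type u} {U : Ultrafilter I} {N : Type u}

theorem ultraClass_eq_iff {f g : I → N} :
    ultraClass U f = ultraClass U g ↔ ∀ᶠ i in (U : Filter I), f i = g i :=
  Quotient.eq (r := (U : Filter I).productSetoid fun _ => N)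

theorem ultraClass_out (x : Ultrapower U N) : ultraClass U x.out = x :=
  Quotient.out_eq x

theorem funMap_ultraClass [L.Structure N] {n : ℕ} (f : L.Functions n) (x : Fin n → I → N) :
    (Structure.funMap f fun k => ultraClass U (x k)) =
      ultraClass U fun i => Structure.funMap f fun k => x k i :=
  Ultraproduct.funMap_cast (u := U) f x

theorem relMap_ultraClass [L.Structure N] {n : ℕ} (r : L.Relations n) (x : Fin n → I → N) :
    (Structure.RelMap r fun k => ultraClass U (x k)) ↔
      ∀ᶠ i in (U : Filter I), Structure.RelMap r fun k => x k i :=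
  relMap_quotient_mk' (s := (U : Filter I).productSetoid fun _ => N)
    (ps := Ultraproduct.setoidPrestructure (fun _ => N) U) r x

instance ultrapower_isExpansionOn (φ : L →ᴸ L') [L.Structure N] [L'.Structure N]
    [φ.IsExpansionOn N] : φ.IsExpansionOn (Ultrapower U N) where
  map_onFunction {n} f x := by
    obtain ⟨y, rfl⟩ : ∃ y : Fin n → I → N, x = fun k => ultraClass U (y k) :=
      ⟨fun k => (x k).out, funext fun k => (ultraClass_out (x k)).symm⟩
    rw [funMap_ultraClass, funMap_ultraClass]
    simp only [LHom.map_onFunction]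
  map_onRelation {n} r x := by
    obtain ⟨y, rfl⟩ : ∃ y : Fin n → I → N, x = fun k => ultraClass U (y k) :=
      ⟨fun k => (x k).out, funext fun k => (ultraClass_out (x k)).symm⟩
    rw [relMap_ultraClass, relMap_ultraClass]
    simp only [LHom.map_onRelation]

theorem mk_fin_fun_lt {κ : Cardinal.{u}} (hκ : ℵ₀ < κ) {T : Type u} (hT : #T < κ) (n : ℕ) :
    #(Fin n → T) < κ := by
  have : #(Fin n → T) = #T ^ (n : Cardinal.{u}) := by simp
  rw [this]
  exact Cardinal.power_nat_le_max.trans_lt (max_lt hT hκ)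

/-- A small substructure of an ultrapower by a `κ`-complete ultrafilter is embedded into almost
all factors by choosing representatives. -/
theorem eventually_exists_embedding [L.Structure N] {κ : Cardinal.{u}} (hκ : ℵ₀ < κ)
    (hU : CardinalInterFilter (U : Filter I) κ) (hL : L.card < κ)
    (T : L.Substructure (Ultrapower U N)) (hT : #T < κ) :
    ∀ᶠ i in (U : Filter I), ∃ e : T ↪[L] N, ∀ t : T, e t = (t : Ultrapower U N).out i := by
  have hLfun : #(Σ n, L.Functions n) < κ :=
    (Cardinal.mk_le_of_injective (Sum.inl_injective (β := Σ n, L.Relations n))).trans_lt hL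
  have hLrel : #(Σ n, L.Relations n) < κ :=
    (Cardinal.mk_le_of_injective (Sum.inr_injective (α := Σ n, L.Functions n))).trans_lt hL
  -- Each single condition holds almost everywhere; fewer than `κ` symbols and tuples occur, so
  -- `κ`-completeness handles them simultaneously.
  have h1 : ∀ᶠ i in (U : Filter I), ∀ (f : Σ n, L.Functions n) (x : Fin f.1 → T),
      ((Structure.funMap f.2 x : T) : Ultrapower U N).out i =
        Structure.funMap f.2 fun k => (x k : Ultrapower U N).out i := by
    rw [Filter.eventually_cardinal_forall hLfun]
    intro f
    rw [Filter.eventually_cardinal_forall (mk_fin_fun_lt hκ hT _)]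
    intro x
    rw [← ultraClass_eq_iff, ultraClass_out, ← funMap_ultraClass]
    simp only [ultraClass_out]
    rfl
  have h2 : ∀ᶠ i in (U : Filter I), ∀ (r : Σ n, L.Relations n) (x : Fin r.1 → T),
      (Structure.RelMap r.2 fun k => (x k : Ultrapower U N).out i) ↔ Structure.RelMap r.2 x := by
    rw [Filter.eventually_cardinal_forall hLrel]
    intro r
    rw [Filter.eventually_cardinal_forall (mk_fin_fun_lt hκ hT _)]
    intro x
    have h : Structure.RelMap r.2 x ↔
        ∀ᶠ i in (U : Filter I), Structure.RelMap r.2 fun k => (x k : Ultrapower U N).out i := by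
      rw [← relMap_ultraClass]
      simp only [ultraClass_out]
      rfl
    -- Failure of a relation must also be reflected almost everywhere, which uses that `U` is an
    -- ultrafilter.
    by_cases hx : Structure.RelMap r.2 x
    · simpa only [hx, iff_true] using h.1 hx
    · simpa only [hx, iff_false] using Ultrafilter.eventually_not.2 (mt h.2 hx)
  have h3 : ∀ᶠ i in (U : Filter I), ∀ x y : T,
      (x : Ultrapower U N).out i = (y : Ultrapower U N).out i → x = y := by
    rw [Filter.eventually_cardinal_forall hT]
    intro x
    rw [Filter.eventually_cardinal_forall hT]
    intro y
    by_cases hxy : x = y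
    · exact Filter.Eventually.of_forall fun _ _ => hxy
    · simp only [hxy, imp_false]
      refine Ultrafilter.eventually_not.2 fun h => hxy (Subtype.ext ?_)
      rw [← ultraClass_out x.1, ← ultraClass_out y.1]
      exact ultraClass_eq_iff.2 h
  filter_upwards [h1, h2, h3] with i h1 h2 h3
  exact ⟨{ toFun := fun t => (t : Ultrapower U N).out i
           inj' := fun x y h => h3 x y h
           map_fun' := fun f x => h1 ⟨_, f⟩ x
           map_rel' := fun r x => h2 ⟨_, r⟩ x }, fun _ => rfl⟩

/-- The reduct of an embedding between expansions. -/
def FirstOrder.Language.Embedding.substructureReduct {M : Type u} [L.Structure M] [L'.Structure M]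
    [L.Structure N] [L'.Structure N] (φ : L →ᴸ L') [φ.IsExpansionOn M] [φ.IsExpansionOn N]
    {T : L'.Substructure M} (e : T ↪[L'] N) : φ.substructureReduct T ↪[L] N where
  toFun x := e ⟨x, x.2⟩
  inj' x y h := Subtype.ext (congrArg Subtype.val (e.injective h))
  map_fun' {n} f x := by
    have hf : (Structure.funMap (φ.onFunction f) (fun k => (⟨x k, (x k).2⟩ : T)) : T) =
        ⟨(Structure.funMap f x : φ.substructureReduct T),
          (Structure.funMap f x : φ.substructureReduct T).2⟩ :=
      Subtype.ext (LHom.map_onFunction φ f _)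
    have h := e.map_fun (φ.onFunction f) fun k => (⟨x k, (x k).2⟩ : T)
    rw [hf, LHom.map_onFunction] at h
    exact h
  map_rel' {n} r x := by
    have h := e.map_rel (φ.onRelation r) fun k => (⟨x k, (x k).2⟩ : T)
    rw [LHom.map_onRelation] at h
    exact h.trans (iff_of_eq (LHom.map_onRelation φ r fun k => (x k : M)))

end Ultrapower

theorem FirstOrder.Language.Substructure.exists_finite_mem_closure
    {L : FirstOrder.Language.{u, u}} {M : Type u} [L.Structure M] {A : Set M} {x : M}
    (hx : x ∈ Substructure.closure L A) :
    ∃ B : Set M, B.Finite ∧ B ⊆ A ∧ x ∈ Substructure.closure L B := by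
  refine Substructure.closure_induction
    (p := fun x => ∃ B : Set M, B.Finite ∧ B ⊆ A ∧ x ∈ Substructure.closure L B) hx ?_ ?_
  · intro x hx
    exact ⟨{x}, Set.finite_singleton x, Set.singleton_subset_iff.2 hx,
      Substructure.subset_closure rfl⟩
  · intro n f v hv
    choose B hBfin hBA hB using hv
    exact ⟨⋃ k, B k, Set.finite_iUnion hBfin, Set.iUnion_subset hBA,
      Substructure.fun_mem _ f v fun k =>
        Substructure.closure_mono (Set.subset_iUnion B k) (hB k)⟩

theorem FirstOrder.Language.Substructure.card_closure_lt {L : FirstOrder.Language.{u, u}}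
    {M : Type u} [L.Structure M] {A : Set M} {κ : Cardinal.{u}} (hκ : ℵ₀ < κ) (hL : L.card < κ)
    (hA : #A < κ) : #(Substructure.closure L A) < κ := by
  have h := Substructure.lift_card_closure_le (L := L) (s := A)
  simp only [Cardinal.lift_id] at h
  exact h.trans_lt (max_lt hκ (Cardinal.add_lt_of_lt hκ.le hA
    ((Cardinal.mk_le_of_injective (Sum.inl_injective (β := Σ n, L.Relations n))).trans_lt hL)))

/-! ### Strong substructures and Galois types in the ultrapower. -/

namespace AEC

open FirstOrder.Language

variable {L L' : FirstOrder.Language.{u, u}} {K : AEC L} {φ : L →ᴸ L'}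

theorem IsSkolemized.isEmbedding_substructureReduct {M N : Type u} [L.Structure M]
    [L'.Structure M] [φ.IsExpansionOn M] [L.Structure N] [L'.Structure N] [φ.IsExpansionOn N]
    (hN : K.IsSkolemized φ N) {T : L'.Substructure M} (e : T ↪[L'] N) :
    K.IsEmbedding (e.substructureReduct φ) :=
  hN e.toHom.range

/-- By finitarity of closure, only the closures of `A ⊆ B` with `B` finite need comparing. The
closure of `B` has size `< κ`, so it embeds into `N`; both images are strong there, and coherence
applies. -/
theorem IsSkolemized.ultrapower {N : Type u} [L.Structure N] [L'.Structure N]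
    [φ.IsExpansionOn N] (hN : K.IsSkolemized φ N) {κ : Cardinal.{u}} (hκ : ℵ₀ < κ)
    (hL' : L'.card < κ) {I : Type u} {U : Ultrafilter I}
    (hU : CardinalInterFilter (U : Filter I) κ) : K.IsSkolemized φ (Ultrapower U N) := by
  intro T
  have h := strongIn_of_finitary (K := K)
    (C := fun A : Set (Ultrapower U N) => φ.substructureReduct (Substructure.closure L' A))
    (fun A B hAB => φ.substructureReduct.monotone (Substructure.closure_mono hAB))
    (fun A x hx => Substructure.exists_finite_mem_closure hx) ?_ T Set.univ (Set.subset_univ _)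
  · simp only [Substructure.closure_eq, Substructure.closure_univ] at h
    exact strongIn_top_iff.1 h
  · intro A B hB hAB
    have hle := Substructure.closure_mono (L := L') hAB
    have hlt : #(Substructure.closure L' B) < κ := Substructure.card_closure_lt hκ hL'
      ((Cardinal.lt_aleph0_iff_set_finite.2 hB).trans hκ)
    obtain ⟨i, e, -⟩ := (eventually_exists_embedding hκ hU hL' _ hlt).exists
    have hle' : φ.substructureReduct (Substructure.closure L' A) ≤
      φ.substructureReduct (Substructure.closure L' B) := hle
    rw [strongIn_iff_isEmbedding_inclusion hle']
    exact (hN.isEmbedding_substructureReduct e).of_comp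
      (hN.isEmbedding_substructureReduct (e.comp (Substructure.inclusion hle)))

theorem IsSkolemized.isEmbedding_ultrapowerEmbedding {N : Type u} [L.Structure N]
    [L'.Structure N] [φ.IsExpansionOn N] {I : Type u} {U : Ultrafilter I}
    (hU : K.IsSkolemized φ (Ultrapower U N)) :
    K.IsEmbedding (ultrapowerEmbedding (L := L) U N) :=
  hU (ultrapowerEmbedding (L := L') U N).toHom.range

/-- The type over `N₀` of a sequence in an ultrapower of `N` is almost everywhere equal to the
type of the corresponding sequence in `N`. -/
theorem IsSkolemized.eventually_tp_eq {N : Type u} [L.Structure N]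
    [L'.Structure N] [φ.IsExpansionOn N] (hN : K.IsSkolemized φ N) {κ : Cardinal.{u}}
    (hκ : ℵ₀ < κ) (hL' : L'.card < κ) {I : Type u} {U : Ultrafilter I}
    (hU : CardinalInterFilter (U : Filter I) κ) {N₀ : L.Substructure N} (hN₀ : K.Strong N₀)
    (h : K.IsEmbedding ((ultrapowerEmbedding (L := L) U N).comp N₀.subtype))
    {J : Type u} (hcard : #N₀ + #J < κ) (g : I → J → N) :
    ∀ᶠ i in (U : Filter I), tp hN₀ (g i) = Quotient.mk (K.pretypeSetoid J N₀)
      ⟨Ultrapower U N, (ultrapowerEmbedding (L := L) U N).comp N₀.subtype, h,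
        fun j => ultraClass U fun i => g i j⟩ := by
  let b : N₀ → Ultrapower U N := fun x => ultraClass U fun _ => x
  let c : J → Ultrapower U N := fun j => ultraClass U fun i => g i j
  -- A small structure carrying all the data of the type, through which the ultrapower is compared
  -- with `N`.
  let T := Substructure.closure L' (Set.range b ∪ Set.range c)
  have hb : ∀ x, b x ∈ φ.substructureReduct T := fun x =>
    Substructure.subset_closure (Or.inl ⟨x, rfl⟩)
  have hc : ∀ j, c j ∈ φ.substructureReduct T := fun j =>
    Substructure.subset_closure (Or.inr ⟨j, rfl⟩)
  have hT : #T < κ := Substructure.card_closure_lt hκ hL' (((Cardinal.mk_union_le _ _).trans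
    (add_le_add Cardinal.mk_range_le Cardinal.mk_range_le)).trans_lt hcard)
  have hsub : K.IsEmbedding (φ.substructureReduct T).subtype :=
    isEmbedding_subtype (hN.ultrapower hκ hL' hU T)
  let incl : N₀ ↪[L] φ.substructureReduct T :=
    Embedding.codRestrict _ ((ultrapowerEmbedding (L := L) U N).comp N₀.subtype) hb
  have hincl : K.IsEmbedding incl := hsub.of_comp (f := incl) h
  let P : K.Pretype J N₀ := ⟨φ.substructureReduct T, incl, hincl, fun j => ⟨c j, hc j⟩⟩
  -- The chosen representative of a constant class need not be constant, but it agrees with the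
  -- constant almost everywhere.
  have h1 : ∀ᶠ i in (U : Filter I), ∀ x, (b x).out i = x :=
    (Filter.eventually_cardinal_forall (le_self_add.trans_lt hcard)).2 fun x =>
      ultraClass_eq_iff.1 (ultraClass_out _)
  have h2 : ∀ᶠ i in (U : Filter I), ∀ j, (c j).out i = g i j :=
    (Filter.eventually_cardinal_forall (le_add_self.trans_lt hcard)).2 fun j =>
      ultraClass_eq_iff.1 (ultraClass_out _)
  filter_upwards [h1, h2, eventually_exists_embedding hκ hU hL' T hT] with i h1 h2 ⟨e, he⟩
  -- Both types equal that of the pretype `P` living in `T`: one by the embedding `e` into `N`, the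
  -- other by the inclusion into the ultrapower.
  refine (Quotient.sound (s := K.pretypeSetoid J N₀) (a := P) ?_).symm.trans
    (Quotient.sound (s := K.pretypeSetoid J N₀) (a := P) ?_)
  · refine .single ⟨N, inferInstance, e.substructureReduct φ, Embedding.refl L N,
      hN.isEmbedding_substructureReduct e, isEmbedding_refl (K.mem_of_strong _ hN₀).2,
      fun j => ?_, fun x => ?_⟩
    · exact (he _).trans (h2 j)
    · exact (he _).trans (h1 x)
  · exact .single ⟨Ultrapower U N, inferInstance, (φ.substructureReduct T).subtype,
      Embedding.refl L _, hsub, isEmbedding_refl hsub.mem_right, fun j => rfl, fun x => rfl⟩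

/-! ### Transport of types along isomorphisms, and the main theorem. -/

theorem Pretype.mk_congr {J M N : Type u} [L.Structure M] [L.Structure N] {f f' : M ↪[L] N}
    (hff' : f = f') (hf : K.IsEmbedding f) (hf' : K.IsEmbedding f') (a : J → N) :
    (⟨N, f, hf, a⟩ : K.Pretype J M) = ⟨N, f', hf', a⟩ := by
  subst hff'
  rfl

theorem Pretype.map_symm_map {J M M' : Type u} [L.Structure M] [L.Structure M'] (e : M ≃[L] M')
    (p : K.Pretype J M) : (p.map e).map e.symm = p := by
  obtain ⟨N, incl, h, a⟩ := p
  have : (incl.comp e.symm.toEmbedding).comp e.symm.symm.toEmbedding = incl := by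
    ext x
    exact congrArg incl (e.symm_apply_apply x)
  exact Pretype.mk_congr this _ _ _

theorem GaloisType.map_injective {J M M' : Type u} [L.Structure M] [L.Structure M']
    (e : M ≃[L] M') : Function.Injective (GaloisType.map (K := K) (J := J) e) := by
  have h : Function.LeftInverse (GaloisType.map (K := K) (J := J) e.symm) (GaloisType.map e) := by
    intro p
    induction p using Quotient.inductionOn with
    | h p => exact congrArg (Quotient.mk (K.pretypeSetoid J M)) (p.map_symm_map e)
  exact h.injective

/-- Together with `GaloisType.map_injective`, this moves the question of realizing `h(p)` over
`h(N₀)` back to an equality of types over `N₀`. -/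
theorem map_substructureEquivMap_eq_tp {N N' : Type u} [L.Structure N] [L.Structure N']
    {N₀ : L.Substructure N} (f : N ↪[L] N') (hf : K.IsEmbedding (f.comp N₀.subtype))
    (hN₀ : K.Strong (N₀.map f.toHom)) {J : Type u} (a : J → N') :
    GaloisType.map (f.substructureEquivMap N₀)
      (Quotient.mk (K.pretypeSetoid J N₀) ⟨N', f.comp N₀.subtype, hf, a⟩) = tp hN₀ a := by
  have : (f.comp N₀.subtype).comp (f.substructureEquivMap N₀).symm.toEmbedding =
      (N₀.map f.toHom).subtype := by
    ext x
    obtain ⟨y, rfl⟩ := (f.substructureEquivMap N₀).surjective x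
    exact congrArg (f.comp N₀.subtype) ((f.substructureEquivMap N₀).symm_apply_apply y)
  refine congrArg (Quotient.mk (K.pretypeSetoid J (N₀.map f.toHom))) ?_
  exact Pretype.mk_congr this _ _ _

end AEC

theorem mainTheorem10 {L : FirstOrder.Language.{u, u}} (K : AEC L) (κ : Cardinal.{u})
    (hκ : IsMeasurableCardinal κ) (hLS : K.LS < κ)
    {I : Type u} (U : Ultrafilter I) (hU : CardinalInterFilter (U : Filter I) κ)
    {N : Type u} [L.Structure N] (N₀ : L.Substructure N) (hN₀ : K.Strong N₀)
    {J : Type u} (p : K.GaloisType J N₀) (hcard : #N₀ + #J < κ) (g : I → J → N) :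
    K.IsEmbedding (ultrapowerEmbedding (L := L) U N) ∧
    ∃ hh : K.Strong (N₀.map (ultrapowerEmbedding (L := L) U N).toHom),
      (AEC.Realizes hh (fun j => ultraClass U fun i => g i j)
          (p.map ((ultrapowerEmbedding (L := L) U N).substructureEquivMap N₀)) ↔
        {i | AEC.Realizes hN₀ (g i) p} ∈ U) := by
  obtain ⟨L', φ, _, _, hL', hN⟩ := AEC.exists_isSkolemized (K.mem_of_strong _ hN₀).2
  have hL'κ := hL'.trans_lt hLS
  have hemb := (hN.ultrapower hκ.1 hL'κ hU).isEmbedding_ultrapowerEmbedding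
  have hcomp := hemb.comp (AEC.isEmbedding_subtype hN₀)
  have hrange : ((ultrapowerEmbedding (L := L) U N).comp N₀.subtype).toHom.range =
      N₀.map (ultrapowerEmbedding (L := L) U N).toHom := by
    ext x
    constructor
    · rintro ⟨y, rfl⟩
      exact ⟨y, y.2, rfl⟩
    · rintro ⟨y, hy, rfl⟩
      exact ⟨⟨y, hy⟩, rfl⟩
  have hh : K.Strong (N₀.map (ultrapowerEmbedding (L := L) U N).toHom) := hrange ▸ hcomp
  have hev := hN.eventually_tp_eq hκ.1 hL'κ hU hN₀ hcomp hcard g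
  refine ⟨hemb, hh, ?_⟩
  unfold AEC.Realizes
  rw [← AEC.map_substructureEquivMap_eq_tp _ hcomp hh]
  refine (AEC.GaloisType.map_injective _).eq_iff.trans ?_
  -- Almost all `g i` have one and the same type `q` over `N₀`, and the left side says `q = p`. For
  -- the converse, two sets in `U` share an index, which yields `q = p`.
  constructor
  · intro h
    filter_upwards [hev] with i hi
    exact hi.trans h
  · intro h
    obtain ⟨i, hi, hi'⟩ := (hev.and h).exists
    exact hi.symm.trans hi'
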